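/- There is an absolute constant $c>0$ such that for every $n$ and every graph $H$ on $n$ vertices with at least one edge (isolated vertices are allowed), $Q(f_H)\ \ge\ c\,n^{3/4}$. Here $f_H:\{0,1\}^{\binom n2}\to\{0,1\}$ is the Boolean function whose input is a graph $G$ on $n$ vertices, given by one bit for each unordered pair of distinct vertices, with $f_H(G)=1$ if and only if $G$ contains a (not necessarily induced) subgraph isomorphic to $H$. For a Boolean function $f$ of variables $x_i$, $i\in I$, with $I$ finite, $Q(f)$ denotes the bounded-error quantum query complexity: the least $q$ for which there are a number of work qubits and unitary transformations $U_0,\dots,U_q$, independent of the input $x$, such that for every input $x$, measuring the designated output qubit of $U_qO_xU_{q-1}\cdots O_xU_1O_xU_0|0\rangle$ yields $f(x)$ with probability at least $2/3$. The basis states are $|i,z\rangle$, where $i\in I\cup\{\varnothing\}$ is the content of the query register and $z$ that of the work qubits, $|0\rangle=|\varnothing,0\cdots0\rangle$, and the query transformation is $O_x|i,z\rangle=(-1)^{x_i}|i,z\rangle$ for $i\in I$ and $O_x|\varnothing,z\rangle=|\varnothing,z\rangle$. -/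

import Mathlib

open scoped ENNReal

/-! ### Bounded-error quantum query algorithms -/

/-- The computational basis of the space on which a query algorithm for inputs `x : ι → Bool`
acts. A basis state consists of the content of the query register (the name of an input variable,
or `none` for the null query) and of the contents of `m + 1` work qubits. -/
abbrev QBasis (ι : Type*) (m : ℕ) : Type _ := Option ι × (Fin (m + 1) → Bool)

/-- A quantum query algorithm `U_q O U_{q-1} ⋯ O U_1 O U_0` with `q = queries` queries, with
`work + 1` work qubits, and with unitaries that do not depend on the input.
Only `U 0, …, U queries` are ever used. -/
structure QueryAlgorithm (ι : Type*) [Fintype ι] [DecidableEq ι] where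
  /-- the number of queries -/
  queries : ℕ
  /-- the number of work qubits besides the output qubit -/
  work : ℕ
  /-- the unitary transformations, independent of the input -/
  U : ℕ → Matrix.unitaryGroup (QBasis ι work) ℂ

/-- The query transformation `O_x`: it multiplies the amplitude of a basis state by `-1` if its
query register names a variable `i` with `x i = 1`, and fixes all other basis states. -/
def queryOp {ι : Type*} {m : ℕ} (x : ι → Bool) (ψ : QBasis ι m → ℂ) : QBasis ι m → ℂ :=
  fun s => match s.1 with
    | none => ψ s
    | some i => if x i = true then -ψ s else ψ s

namespace QueryAlgorithm

variable {ι : Type*} [Fintype ι] [DecidableEq ι]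

/-- The all-zero initial basis state. -/
def start (m : ℕ) : QBasis ι m → ℂ := Pi.single (none, fun _ => false) 1

/-- The state `U_k O_x U_{k-1} ⋯ O_x U_0 |0⟩` of the algorithm on input `x` after `k` queries. -/
noncomputable def stateAfter (A : QueryAlgorithm ι) (x : ι → Bool) : ℕ → QBasis ι A.work → ℂ
  | 0 => (A.U 0 : Matrix (QBasis ι A.work) (QBasis ι A.work) ℂ).mulVec (start A.work)
  | k + 1 => (A.U (k + 1) : Matrix (QBasis ι A.work) (QBasis ι A.work) ℂ).mulVec
      (queryOp x (A.stateAfter x k))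

/-- The probability that measuring the final state in the computational basis yields the value
`b` for the output qubit (the last work qubit). -/
noncomputable def outputProb (A : QueryAlgorithm ι) (x : ι → Bool) (b : Bool) : ℝ :=
  ∑ s : QBasis ι A.work, if s.2 (Fin.last A.work) = b then ‖A.stateAfter x A.queries s‖ ^ 2 else 0

/-- `A` computes `f` with bounded error: on every input, the output is correct with probability
at least `2/3`. -/
def Computes (A : QueryAlgorithm ι) (f : (ι → Bool) → Bool) : Prop :=
  ∀ x : ι → Bool, 2 / 3 ≤ A.outputProb x (f x)

end QueryAlgorithm

/-- The bounded-error quantum query complexity `Q(f)`: the least number of queries of a quantum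
query algorithm that computes `f` with bounded error. -/
noncomputable def quantumQueryComplexity {ι : Type*} [Fintype ι] [DecidableEq ι]
    (f : (ι → Bool) → Bool) : ℕ∞ :=
  ⨅ (A : QueryAlgorithm ι) (_ : A.Computes f), (A.queries : ℕ∞)

/-! ### The subgraph isomorphism problem -/

/-- The input variables of a graph problem on the vertex set `V`: the unordered pairs of distinct
vertices. -/
abbrev EdgeVar (V : Type*) : Type _ := {e : Sym2 V // ¬ e.IsDiag}

/-- The graph on `V` described by the truth values of the edge variables. -/
def graphOfInput {V : Type*} (x : EdgeVar V → Bool) : SimpleGraph V :=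
  SimpleGraph.fromEdgeSet {e | ∃ h : ¬ e.IsDiag, x ⟨e, h⟩ = true}

open Classical in
/-- The function `f_H`: its value is `1` exactly if the input graph `G` contains a (not
necessarily induced) subgraph isomorphic to `H`. -/
noncomputable def subgraphIsoFn {V : Type*} (H : SimpleGraph V) (x : EdgeVar V → Bool) : Bool :=
  decide (H.IsContained (graphOfInput x))

/-! Let `n` be the number of vertices and `q` the number of queries. By the adversary method, the
number of sensitive variables of any input is O(q²). Two kinds of input matter: at `H` itself every
edge is sensitive, and at an edge-maximal `H`-free graph every non-edge is. So, with `W` of order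
q², `H` has at most `W` ordered adjacent pairs, and every `H`-free graph extends to an `H`-free
graph with at most `W` ordered non-adjacent pairs. The aim is n³ = O(W²).

If no independent set has n/4 vertices, take an independent `U` with fewest neighbors for its size,
that size being the largest for which at most n/4 neighbors are possible. Either all neighbors of
`U` see more than half of `U`, which forces many edges of `H`, or deleting one neighbor from the
pattern gives an `H`-free graph all of whose `H`-free extensions have many non-edges
(`card_mul_card_le_of_minimal_neighborsOf`). Either way n|U| = O(W), and a greedy choice gives |U|
of order at least n/(1 + W/n); multiplying yields the bound (`exists_large_indep`).

Otherwise let `S` be a maximum independent set, `N = |S| + 1`, and `t` the least number of neighbors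
in `S` of an outside vertex. The two sensitivity bounds give N(N - t) ≤ W and (n - |S|)t ≤ W, so if
t ≥ N/2 then p = n - t satisfies pN = O(W). Sensitivity alone no longer suffices. Make a graph
complete except inside an `N`-set, where N/2 centers are joined to everything but a block of `p`
vertices each. It is `H`-free, yet contains `H` once one center regains its block. Locating that
center among N/2, with N/(2p) possible blocks, costs q² of order N²/p by the adversary bound
(`mul_le_of_blocks`). Together with pN = O(W) this gives N³ = O(W²). -/

/-! ### The adversary bound -/

namespace QueryAlgorithm

variable {ι : Type*}

/-- The inputs `x` and `y` differ at the variable named by the query register of `s`. -/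
def Distinguishes {m : ℕ} (x y : ι → Bool) (s : QBasis ι m) : Prop :=
  ∃ i, s.1 = some i ∧ x i ≠ y i

lemma Distinguishes.symm {m : ℕ} {x y : ι → Bool} {s : QBasis ι m} (h : Distinguishes x y s) :
    Distinguishes y x s := by
  obtain ⟨i, hi, hne⟩ := h
  exact ⟨i, hi, hne.symm⟩

lemma norm_queryOp {m : ℕ} (x : ι → Bool) (ψ : QBasis ι m → ℂ) (s : QBasis ι m) :
    ‖queryOp x ψ s‖ = ‖ψ s‖ := by
  rcases s with ⟨_ | i, z⟩
  · simp [queryOp]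
  · by_cases h : x i = true <;> simp [queryOp, h]

/-- Both amplitudes receive the same sign unless the inputs differ at the queried variable, so the
other terms of the inner product are unchanged. -/
lemma norm_query_sub_le {m : ℕ} (x y : ι → Bool) (ψ φ : QBasis ι m → ℂ) (s : QBasis ι m)
    [Decidable (Distinguishes x y s)] :
    ‖star (ψ s) * φ s - star (queryOp x ψ s) * queryOp y φ s‖ ≤
      if Distinguishes x y s then 2 * (‖ψ s‖ * ‖φ s‖) else 0 := by
  split_ifs with h
  · refine (norm_sub_le _ _).trans ?_
    simp only [norm_mul, norm_star, norm_queryOp]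
    linarith
  · rcases s with ⟨_ | i, z⟩
    · simp [queryOp]
    · have hi : x i = y i := by
        by_contra hne
        exact h ⟨i, rfl, hne⟩
      by_cases hx : y i = true <;> simp [queryOp, hi, hx]

variable [Fintype ι] [DecidableEq ι]

lemma unitary_star_dotProduct {κ : Type*} [Fintype κ] [DecidableEq κ]
    (U : Matrix.unitaryGroup κ ℂ) (v w : κ → ℂ) :
    star ((U : Matrix κ κ ℂ).mulVec v) ⬝ᵥ (U : Matrix κ κ ℂ).mulVec w = star v ⬝ᵥ w := by
  rw [Matrix.star_mulVec, Matrix.dotProduct_mulVec, Matrix.vecMul_vecMul,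
    ← Matrix.star_eq_conjTranspose, Matrix.UnitaryGroup.star_mul_self, Matrix.vecMul_one]

lemma star_dotProduct_self {κ : Type*} [Fintype κ] (v : κ → ℂ) :
    star v ⬝ᵥ v = ((∑ s, ‖v s‖ ^ 2 : ℝ) : ℂ) := by
  simp only [dotProduct, Pi.star_apply, RCLike.star_def, Complex.ofReal_sum]
  refine Finset.sum_congr rfl fun s _ => ?_
  rw [Complex.conj_mul', Complex.ofReal_pow]

lemma sum_norm_sq_stateAfter (A : QueryAlgorithm ι) (x : ι → Bool) (k : ℕ) :
    ∑ s, ‖A.stateAfter x k s‖ ^ 2 = 1 := by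
  have key : ∀ (U : Matrix.unitaryGroup (QBasis ι A.work) ℂ) (v : QBasis ι A.work → ℂ),
      ∑ s, ‖(U : Matrix (QBasis ι A.work) (QBasis ι A.work) ℂ).mulVec v s‖ ^ 2 = ∑ s, ‖v s‖ ^ 2 := by
    intro U v
    have h := unitary_star_dotProduct U v v
    rw [star_dotProduct_self, star_dotProduct_self] at h
    exact_mod_cast h
  induction k with
  | zero =>
    rw [stateAfter, key, start]
    rw [Finset.sum_eq_single (none, fun _ => false)]
    · simp
    · intro s _ hs
      simp [Pi.single_eq_of_ne hs]
    · simp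
  | succ k ih =>
    rw [stateAfter, key, ← ih]
    simp only [norm_queryOp]

lemma overlap_zero (A : QueryAlgorithm ι) (x y : ι → Bool) :
    ‖star (A.stateAfter x 0) ⬝ᵥ A.stateAfter y 0‖ = 1 := by
  have h : A.stateAfter y 0 = A.stateAfter x 0 := rfl
  rw [h, star_dotProduct_self, sum_norm_sq_stateAfter]
  simp

open Classical in
-- Unitaries preserve inner products, so only the query matters. The changed terms, at most `2‖ψ
-- s‖‖φ s‖`, are split by AM-GM with a free weight `a`.
lemma overlap_succ (A : QueryAlgorithm ι) (x y : ι → Bool) (k : ℕ) {a : ℝ} (ha : 0 < a) :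
    ‖star (A.stateAfter x k) ⬝ᵥ A.stateAfter y k‖ ≤
      ‖star (A.stateAfter x (k + 1)) ⬝ᵥ A.stateAfter y (k + 1)‖ +
      (a * ∑ s, (if Distinguishes x y s then ‖A.stateAfter x k s‖ ^ 2 else 0) +
       a⁻¹ * ∑ s, (if Distinguishes x y s then ‖A.stateAfter y k s‖ ^ 2 else 0)) := by
  rw [stateAfter, stateAfter, unitary_star_dotProduct]
  set ψ := A.stateAfter x k
  set φ := A.stateAfter y k
  have h1 : star ψ ⬝ᵥ φ = star (queryOp x ψ) ⬝ᵥ queryOp y φ +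
      ∑ s, (star (ψ s) * φ s - star (queryOp x ψ s) * queryOp y φ s) := by
    rw [Finset.sum_sub_distrib]
    simp [dotProduct]
  rw [h1]
  refine (norm_add_le _ _).trans (add_le_add le_rfl ?_)
  refine (norm_sum_le _ _).trans ?_
  rw [Finset.mul_sum, Finset.mul_sum, ← Finset.sum_add_distrib]
  refine Finset.sum_le_sum fun s _ => (norm_query_sub_le x y ψ φ s).trans ?_
  split_ifs with h
  · have h2 : a * a⁻¹ = 1 := mul_inv_cancel₀ ha.ne'
    have h3 : 0 < a⁻¹ := inv_pos.mpr ha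
    have h4 : 0 ≤ a * (‖ψ s‖ - a⁻¹ * ‖φ s‖) ^ 2 := by positivity
    have h5 : a * (‖ψ s‖ - a⁻¹ * ‖φ s‖) ^ 2 =
      a * ‖ψ s‖ ^ 2 - 2 * (a * a⁻¹) * (‖ψ s‖ * ‖φ s‖) + (a * a⁻¹) * a⁻¹ * ‖φ s‖ ^ 2 := by ring
    rw [h5, h2] at h4
    linarith
  · simp

lemma overlap_final (A : QueryAlgorithm ι) {f : (ι → Bool) → Bool} (hA : A.Computes f)
    {x y : ι → Bool} (hx : f x = true) (hy : f y = false) :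
    ‖star (A.stateAfter x A.queries) ⬝ᵥ A.stateAfter y A.queries‖ ≤ 17 / 18 := by
  have px := hA x
  have py := hA y
  rw [hx] at px
  rw [hy] at py
  have nx := sum_norm_sq_stateAfter A x A.queries
  have ny := sum_norm_sq_stateAfter A y A.queries
  unfold outputProb at px py
  set ψ := A.stateAfter x A.queries
  set φ := A.stateAfter y A.queries
  -- AM-GM with weights 1/3 and 3/4, the smaller one on the state for which the output is correct.
  -- Success probability 2/3 gives 3/2 - 2 · (5/12) · (2/3) = 17/18 in total.
  have hp : ∀ s, ‖ψ s‖ * ‖φ s‖ ≤ 3 / 4 * ‖ψ s‖ ^ 2 + 3 / 4 * ‖φ s‖ ^ 2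
      - 5 / 12 * (if s.2 (Fin.last A.work) = true then ‖ψ s‖ ^ 2 else 0)
      - 5 / 12 * (if s.2 (Fin.last A.work) = false then ‖φ s‖ ^ 2 else 0) := by
    intro s
    cases s.2 (Fin.last A.work)
    · simp only [Bool.false_eq_true, if_false, if_true]
      nlinarith [sq_nonneg (3 * ‖ψ s‖ - 2 * ‖φ s‖)]
    · simp only [Bool.true_eq_false, if_false, if_true]
      nlinarith [sq_nonneg (2 * ‖ψ s‖ - 3 * ‖φ s‖)]
  calc ‖star ψ ⬝ᵥ φ‖ ≤ ∑ s, ‖ψ s‖ * ‖φ s‖ := by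
        refine (norm_sum_le _ _).trans (le_of_eq ?_)
        simp
    _ ≤ _ := Finset.sum_le_sum fun s _ => hp s
    _ ≤ 17 / 18 := by
        rw [Finset.sum_sub_distrib, Finset.sum_sub_distrib, Finset.sum_add_distrib,
          ← Finset.mul_sum, ← Finset.mul_sum, ← Finset.mul_sum, ← Finset.mul_sum, nx, ny]
        linarith

open Classical in
-- A basis state queries at most one variable, and at most one partner differs from `x` there, so
-- each squared amplitude is counted at most once.
lemma sum_distinguishes_le (A : QueryAlgorithm ι) (k : ℕ) {β : Type*} [Fintype β]
    (x : ι → Bool) (y : β → ι → Bool) (R : β → Prop)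
    (h : ∀ i b b', R b → R b' → x i ≠ y b i → x i ≠ y b' i → b = b') :
    ∑ b, (if R b then ∑ s, (if Distinguishes x (y b) s then ‖A.stateAfter x k s‖ ^ 2 else 0)
      else 0) ≤ 1 := by
  rw [← sum_norm_sq_stateAfter A x k, ← Finset.sum_filter, Finset.sum_comm]
  refine Finset.sum_le_sum fun s _ => ?_
  rw [← Finset.sum_filter, Finset.sum_const, nsmul_eq_mul]
  have hc : (Finset.filter (fun b => Distinguishes x (y b) s)
      (Finset.filter (fun b => R b) Finset.univ)).card ≤ 1 := by
    rw [Finset.card_le_one]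
    intro b hb b' hb'
    simp only [Finset.mem_filter, Finset.mem_univ, true_and] at hb hb'
    obtain ⟨hR, i, hi, hne⟩ := hb
    obtain ⟨hR', i', hi', hne'⟩ := hb'
    obtain rfl : i = i' := Option.some.inj (hi.symm.trans hi')
    exact h i b b' hR hR' hne hne'
  have hc' : ((Finset.filter (fun b => Distinguishes x (y b) s)
      (Finset.filter (fun b => R b) Finset.univ)).card : ℝ) ≤ 1 := by exact_mod_cast hc
  nlinarith [sq_nonneg ‖A.stateAfter x k s‖]

open Classical in
/-- Ambainis' unweighted adversary bound, for relations in which every input has at most one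
partner that differs from it at a given variable. -/
theorem adversary_bound (A : QueryAlgorithm ι) {f : (ι → Bool) → Bool} (hA : A.Computes f)
    {α β : Type*} [Fintype α] [Fintype β] [Nonempty α]
    (x : α → ι → Bool) (y : β → ι → Bool) (R : α → β → Prop)
    (hx : ∀ a, f (x a) = true) (hy : ∀ b, f (y b) = false) {m m' : ℕ}
    (hm : ∀ a, m ≤ (Finset.univ.filter fun b => R a b).card)
    (hm' : ∀ b, m' ≤ (Finset.univ.filter fun a => R a b).card)
    (hl : ∀ a i b b', R a b → R a b' → x a i ≠ y b i → x a i ≠ y b' i → b = b')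
    (hl' : ∀ b i a a', R a b → R a' b → x a i ≠ y b i → x a' i ≠ y b i → a = a') :
    m * m' ≤ 1296 * A.queries ^ 2 := by
  rcases Nat.eq_zero_or_pos m with rfl | hmpos
  · simp
  rcases Nat.eq_zero_or_pos m' with rfl | hmpos'
  · simp
  -- Progress measure: the total overlap of related pairs. It starts at `E`, must fall to 17/18 of
  -- it, and drops by a bounded amount per query.
  set W : ℕ → ℝ := fun k => ∑ a, ∑ b, if R a b then
    ‖star (A.stateAfter (x a) k) ⬝ᵥ A.stateAfter (y b) k‖ else 0 with hW
  set E : ℝ := ∑ a, ∑ b, if R a b then (1 : ℝ) else 0 with hE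
  have hW0 : W 0 = E := by
    simp only [hW, hE, overlap_zero]
  have hWq : W A.queries ≤ 17 / 18 * E := by
    simp only [hW, hE, Finset.mul_sum]
    refine Finset.sum_le_sum fun a _ => Finset.sum_le_sum fun b _ => ?_
    split_ifs
    · simpa using overlap_final A hA (hx a) (hy b)
    · simp
  have hstep : ∀ (c : ℝ), 0 < c → ∀ k,
      W k ≤ W (k + 1) + (c * Fintype.card α + c⁻¹ * Fintype.card β) := by
    intro c hc k
    have h1 : W k ≤ W (k + 1) +
        (c * (∑ a, ∑ b, if R a b then
          ∑ s, (if Distinguishes (x a) (y b) s then ‖A.stateAfter (x a) k s‖ ^ 2 else 0) else 0) +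
        c⁻¹ * (∑ b, ∑ a, if R a b then
          ∑ s, (if Distinguishes (y b) (x a) s then ‖A.stateAfter (y b) k s‖ ^ 2 else 0)
          else 0)) := by
      rw [Finset.sum_comm (s := (Finset.univ : Finset β))]
      simp only [hW, Finset.mul_sum (s := (Finset.univ : Finset α)),
        Finset.mul_sum (s := (Finset.univ : Finset β))]
      simp only [← Finset.sum_add_distrib]
      refine Finset.sum_le_sum fun a _ => Finset.sum_le_sum fun b _ => ?_
      split_ifs
      · refine (overlap_succ A (x a) (y b) k hc).trans (le_of_eq ?_)
        have hs : ∀ s : QBasis ι A.work,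
            Distinguishes (x a) (y b) s ↔ Distinguishes (y b) (x a) s :=
          fun s => ⟨Distinguishes.symm, Distinguishes.symm⟩
        simp only [hs]
      · simp
    have h2 : (∑ a, ∑ b, if R a b then
          ∑ s, (if Distinguishes (x a) (y b) s then ‖A.stateAfter (x a) k s‖ ^ 2 else 0) else 0)
          ≤ (Fintype.card α : ℝ) := by
      refine (Finset.sum_le_sum fun a _ => sum_distinguishes_le A k (x a) y (R a) (hl a)).trans ?_
      simp
    have h3 : (∑ b, ∑ a, if R a b then
          ∑ s, (if Distinguishes (y b) (x a) s then ‖A.stateAfter (y b) k s‖ ^ 2 else 0) else 0)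
          ≤ (Fintype.card β : ℝ) := by
      refine (Finset.sum_le_sum fun b _ => sum_distinguishes_le A k (y b) x (fun a => R a b)
        fun i a a' h h' hne hne' => hl' b i a a' h h' hne.symm hne'.symm).trans ?_
      simp
    have := mul_le_mul_of_nonneg_left h2 hc.le
    have := mul_le_mul_of_nonneg_left h3 (inv_pos.mpr hc).le
    linarith
  have htotal : ∀ (c : ℝ), 0 < c → ∀ k : ℕ,
      W 0 ≤ W k + k * (c * Fintype.card α + c⁻¹ * Fintype.card β) := by
    intro c hc k
    induction k with
    | zero => simp
    | succ k ih =>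
      have := hstep c hc k
      push_cast
      linarith
  have hEα : (m : ℝ) * Fintype.card α ≤ E := by
    have : ∀ a, (m : ℝ) ≤ ∑ b, if R a b then (1 : ℝ) else 0 := by
      intro a
      rw [Finset.sum_boole]
      exact_mod_cast hm a
    calc (m : ℝ) * Fintype.card α = ∑ _a : α, (m : ℝ) := by simp [mul_comm]
      _ ≤ E := Finset.sum_le_sum fun a _ => this a
  have hEβ : (m' : ℝ) * Fintype.card β ≤ E := by
    have : ∀ b, (m' : ℝ) ≤ ∑ a, if R a b then (1 : ℝ) else 0 := by
      intro b
      rw [Finset.sum_boole]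
      exact_mod_cast hm' b
    calc (m' : ℝ) * Fintype.card β = ∑ _b : β, (m' : ℝ) := by simp [mul_comm]
      _ ≤ ∑ b, ∑ a, if R a b then (1 : ℝ) else 0 := Finset.sum_le_sum fun b _ => this b
      _ = E := Finset.sum_comm
  have hmR : (0 : ℝ) < m := by exact_mod_cast hmpos
  have hmR' : (0 : ℝ) < m' := by exact_mod_cast hmpos'
  have hEpos : 0 < E := by
    have : (0 : ℝ) < Fintype.card α := by exact_mod_cast Fintype.card_pos
    exact lt_of_lt_of_le (by positivity) hEα
  set u := Real.sqrt m
  set v := Real.sqrt m'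
  have hu : u * u = m := Real.mul_self_sqrt hmR.le
  have hv : v * v = m' := Real.mul_self_sqrt hmR'.le
  have hupos : 0 < u := Real.sqrt_pos.mpr hmR
  have hvpos : 0 < v := Real.sqrt_pos.mpr hmR'
  -- The weight √(m / m') balances the two sides: after multiplying by `u * v` they become `m * |α|`
  -- and `m' * |β|`, each at most `E`. The constant is 1296 = (2 · 18)².
  have h1 := htotal (u / v) (by positivity) A.queries
  have h2 : u * v * (u / v * Fintype.card α + (u / v)⁻¹ * Fintype.card β) ≤ 2 * E := by
    have : u * v * (u / v * Fintype.card α + (u / v)⁻¹ * Fintype.card β) =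
        u * u * Fintype.card α + v * v * Fintype.card β := by
      field_simp
    rw [this, hu, hv]
    linarith
  have h3 : u * v * E ≤ 36 * A.queries * E := by
    have h4 : E ≤ 18 * (A.queries * (u / v * Fintype.card α + (u / v)⁻¹ * Fintype.card β)) := by
      linarith
    have h5 := mul_le_mul_of_nonneg_left h4 (mul_pos hupos hvpos).le
    have h6 := mul_le_mul_of_nonneg_left h2 (Nat.cast_nonneg (α := ℝ) A.queries)
    linarith
  have h4 : u * v ≤ 36 * A.queries := le_of_mul_le_mul_right h3 hEpos
  have h5 : (u * v) ^ 2 ≤ (36 * A.queries) ^ 2 := by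
    exact pow_le_pow_left₀ (mul_pos hupos hvpos).le h4 2
  have h6 : ((m * m' : ℕ) : ℝ) ≤ ((1296 * A.queries ^ 2 : ℕ) : ℝ) := by
    push_cast
    rw [← hu, ← hv]
    linarith
  exact_mod_cast h6

/-- The query complexity is at least of the order of the square root of the sensitivity. -/
theorem sensitivity_bound (A : QueryAlgorithm ι) {f : (ι → Bool) → Bool} (hA : A.Computes f)
    (x : ι → Bool) (T : Finset ι) (hT : ∀ i ∈ T, f (Function.update x i (!x i)) ≠ f x) :
    T.card ≤ 1296 * A.queries ^ 2 := by
  have hne : ∀ (i j : ι), x j ≠ Function.update x i (!x i) j → i = j := by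
    intro i j h
    by_contra hij
    exact h (by rw [Function.update_of_ne (Ne.symm hij)])
  rcases T.eq_empty_or_nonempty with rfl | hTne
  · simp
  have : Nonempty T := hTne.to_subtype
  -- The relation is a star: `x` against its sensitive neighbors. The value of `f x` decides which
  -- side holds the center.
  by_cases hx : f x = true
  · have := adversary_bound A hA (α := Unit) (β := T) (fun _ => x)
      (fun i => Function.update x i.1 (!x i.1)) (fun _ _ => True) (fun _ => hx)
      (fun i => by have := hT i.1 i.2; rw [hx] at this; simpa using this)
      (m := T.card) (m' := 1) (by simp) (by simp)
      (fun _ j b b' _ _ h h' => Subtype.ext ((hne _ _ h).trans (hne _ _ h').symm))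
      (fun _ _ _ _ _ _ _ _ => rfl)
    simpa using this
  · have hx' : f x = false := by simpa using hx
    have := adversary_bound A hA (α := T) (β := Unit)
      (fun i => Function.update x i.1 (!x i.1)) (fun _ => x) (fun _ _ => True)
      (fun i => by have := hT i.1 i.2; rw [hx'] at this; simpa using this) (fun _ => hx')
      (m := 1) (m' := T.card) (by simp) (by simp)
      (fun _ _ _ _ _ _ _ _ => rfl)
      (fun _ j b b' _ _ h h' => Subtype.ext ((hne _ _ h.symm).trans (hne _ _ h'.symm).symm))
    simpa using this

end QueryAlgorithm

/-! ### Containment of graphs on the same vertex set -/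

open SimpleGraph

/-- The unused part of `t'` is at least as large as the new part of `s'`, so the latter embeds into
it. -/
lemma exists_injOn_extend {V : Type*} [DecidableEq V] {s s' t' : Finset V} {f : V → V}
    (hf : Set.InjOn f s) (hs : s ⊆ s') (hft : ∀ x ∈ s, f x ∈ t') (hc : s'.card ≤ t'.card) :
    ∃ g : V → V, (∀ x ∈ s, g x = f x) ∧ Set.InjOn g s' ∧ ∀ x ∈ s', g x ∈ t' := by
  have hsub : s.image f ⊆ t' := by
    intro y hy
    obtain ⟨x, hx, rfl⟩ := Finset.mem_image.mp hy
    exact hft x hx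
  have hcard : (s' \ s).card ≤ (t' \ s.image f).card := by
    rw [Finset.card_sdiff_of_subset hs, Finset.card_sdiff_of_subset hsub,
      Finset.card_image_of_injOn hf]
    omega
  have he : Nonempty ((s' \ s : Finset V) ↪ (t' \ s.image f : Finset V)) :=
    Function.Embedding.nonempty_of_card_le (by simpa using hcard)
  obtain ⟨e⟩ := he
  have key : ∀ x (h : x ∈ s' \ s), (e ⟨x, h⟩ : V) ∈ t' ∧ (e ⟨x, h⟩ : V) ∉ s.image f :=
    fun x h => Finset.mem_sdiff.mp (e ⟨x, h⟩).2
  refine ⟨fun x => if h : x ∈ s' \ s then e ⟨x, h⟩ else f x, ?_, ?_, ?_⟩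
  · intro x hx
    exact dif_neg (by simp [hx])
  · intro x hx y hy hxy
    have hx' : x ∈ s' := hx
    have hy' : y ∈ s' := hy
    by_cases h1 : x ∈ s <;> by_cases h2 : y ∈ s
    · simp only [Finset.mem_sdiff, h1, h2, not_true_eq_false, and_false, dite_false] at hxy
      exact hf h1 h2 hxy
    · have h2' : y ∈ s' \ s := Finset.mem_sdiff.mpr ⟨hy', h2⟩
      simp only [dif_neg (show x ∉ s' \ s by simp [h1]), dif_pos h2'] at hxy
      exact absurd (hxy ▸ Finset.mem_image_of_mem f h1) (key y h2').2
    · have h1' : x ∈ s' \ s := Finset.mem_sdiff.mpr ⟨hx', h1⟩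
      simp only [dif_neg (show y ∉ s' \ s by simp [h2]), dif_pos h1'] at hxy
      exact absurd (hxy ▸ Finset.mem_image_of_mem f h2) (key x h1').2
    · have h1' : x ∈ s' \ s := Finset.mem_sdiff.mpr ⟨hx', h1⟩
      have h2' : y ∈ s' \ s := Finset.mem_sdiff.mpr ⟨hy', h2⟩
      simp only [dif_pos h1', dif_pos h2'] at hxy
      simpa using e.injective (Subtype.ext hxy)
  · intro x hx
    by_cases h1 : x ∈ s
    · simp only [dif_neg (show x ∉ s' \ s by simp [h1])]
      exact hft x h1
    · have h1' : x ∈ s' \ s := Finset.mem_sdiff.mpr ⟨hx, h1⟩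
      simp only [dif_pos h1']
      exact (key x h1').1

lemma exists_eq_of_injOn {V : Type*} [DecidableEq V] {s t : Finset V} {g : V → V}
    (hg : Set.InjOn g s) (hgt : ∀ x ∈ s, g x ∈ t) (hc : t.card ≤ s.card) {y : V} (hy : y ∈ t) :
    ∃ x ∈ s, g x = y := by
  have h : s.image g = t := by
    refine Finset.eq_of_subset_of_card_le ?_ ?_
    · intro y hy
      obtain ⟨x, hx, rfl⟩ := Finset.mem_image.mp hy
      exact hgt x hx
    · rwa [Finset.card_image_of_injOn hg]
  rw [← h] at hy
  exact Finset.mem_image.mp hy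

open Classical in
/-- If `U` is independent in `H`, then a graph contains `H` as soon as it is complete outside a
set `U'` of the same size, all vertices of `F'` are joined to all of `U'`, the size of `F'` is at
least the number of neighbors of `U` other than `v`, and a further vertex `b` has at least as many
neighbors in `U'` as `v` has in `U`. -/
lemma isContained_of_complete_outside {V : Type*} [Fintype V] {H G : SimpleGraph V}
    {U F U' F' : Finset V} {v b : V} (hcard : U.card = U'.card)
    (hv : v ∉ U) (hvF : v ∉ F) (hFU : Disjoint F U)
    (hF : ∀ a ∈ U, ∀ c, H.Adj a c → c = v ∨ c ∈ F) (hFF' : F.card ≤ F'.card)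
    (hb : b ∉ U') (hbF : b ∉ F') (hFU' : Disjoint F' U')
    (hG1 : ∀ a c, a ∉ U' → c ∉ U' → a ≠ c → G.Adj a c)
    (hG2 : ∀ a ∈ F', ∀ c ∈ U', G.Adj a c)
    (hrow : (U.filter (H.Adj v)).card ≤ (U'.filter (G.Adj b)).card) : H.IsContained G := by
  -- The copy is built by successive extension: neighbors of `v` in `U` go to neighbors of `b` in
  -- `U'`, then `U` to `U'`, `v` to `b`, `F` into `F'`, and the rest anywhere.
  obtain ⟨g₁, -, hg₁, hm₁⟩ := exists_injOn_extend (f := id) (s := ∅) (by simp)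
    (Finset.empty_subset _) (by simp) hrow
  obtain ⟨g₂, he₂, hg₂, hm₂⟩ := exists_injOn_extend hg₁ (Finset.filter_subset _ U)
    (fun x hx => Finset.filter_subset _ U' (hm₁ x hx)) hcard.le
  obtain ⟨g₃, he₃, hg₃, hm₃⟩ := exists_injOn_extend (s' := insert v U) (t' := insert b U') hg₂
    (Finset.subset_insert v U) (fun x hx => Finset.mem_insert_of_mem (hm₂ x hx))
    (by rw [Finset.card_insert_of_notMem hv, Finset.card_insert_of_notMem hb, hcard])
  have hd : Disjoint F (insert v U) := by
    rw [Finset.disjoint_insert_right]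
    exact ⟨hvF, hFU⟩
  have hd' : Disjoint F' (insert b U') := by
    rw [Finset.disjoint_insert_right]
    exact ⟨hbF, hFU'⟩
  have hci : (insert b U').card = (insert v U).card := by
    rw [Finset.card_insert_of_notMem hv, Finset.card_insert_of_notMem hb, hcard]
  obtain ⟨g₄, he₄, hg₄, hm₄⟩ := exists_injOn_extend (s' := F ∪ insert v U)
    (t' := F' ∪ insert b U') hg₃ Finset.subset_union_right
    (fun x hx => Finset.mem_union_right _ (hm₃ x hx))
    (by rw [Finset.card_union_of_disjoint hd, Finset.card_union_of_disjoint hd']; omega)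
  obtain ⟨g, he, hg, -⟩ := exists_injOn_extend (s' := Finset.univ) (t' := Finset.univ) hg₄
    (Finset.subset_univ _) (fun x _ => Finset.mem_univ _) le_rfl
  have hinj : Function.Injective g := fun x y h => hg (by simp) (by simp) h
  have e3 : ∀ x ∈ insert v U, g x = g₃ x := fun x hx => by
    rw [he x (Finset.mem_union_right _ hx), he₄ x hx]
  have e2 : ∀ x ∈ U, g x = g₂ x := fun x hx => by
    rw [e3 x (Finset.mem_insert_of_mem hx), he₃ x hx]
  have gU : ∀ x ∈ U, g x ∈ U' := fun x hx => by rw [e2 x hx]; exact hm₂ x hx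
  have gU' : ∀ x, g x ∈ U' → x ∈ U := by
    intro x hx
    obtain ⟨y, hy, hxy⟩ := exists_eq_of_injOn hg₂ hm₂ hcard.ge hx
    rw [← e2 y hy] at hxy
    rwa [← hinj hxy]
  have gv : g v = b := by
    obtain ⟨y, hy, hxy⟩ := exists_eq_of_injOn hg₃ hm₃ hci.le (Finset.mem_insert_self b U')
    rw [← e3 y hy] at hxy
    rcases Finset.mem_insert.mp hy with rfl | hy'
    · exact hxy
    · exact absurd (hxy ▸ gU y hy') hb
  have gF : ∀ x ∈ F, g x ∈ F' := by
    intro x hx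
    have h1 := hm₄ x (Finset.mem_union_left _ hx)
    rw [← he x (Finset.mem_union_left _ hx)] at h1
    rcases Finset.mem_union.mp h1 with h1 | h1
    · exact h1
    · obtain ⟨y, hy, hxy⟩ := exists_eq_of_injOn hg₃ hm₃ hci.le h1
      rw [← e3 y hy] at hxy
      exact absurd (hinj hxy ▸ hy) (Finset.disjoint_left.mp hd hx)
  have gP : ∀ x ∈ U, H.Adj v x → G.Adj b (g x) := by
    intro x hx hvx
    have hx' : x ∈ U.filter (H.Adj v) := Finset.mem_filter.mpr ⟨hx, hvx⟩
    rw [e2 x hx, he₂ x hx']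
    exact (Finset.mem_filter.mp (hm₁ x hx')).2
  have hmix : ∀ x y, x ∈ U → H.Adj x y → G.Adj (g x) (g y) := by
    intro x y hx hxy
    rcases hF x hx y hxy with rfl | hy
    · rw [gv]
      exact (gP x hx hxy.symm).symm
    · exact (hG2 _ (gF y hy) _ (gU x hx)).symm
  refine ⟨⟨⟨g, ?_⟩, hinj⟩⟩
  intro x y hxy
  by_cases hx : x ∈ U
  · exact hmix x y hx hxy
  by_cases hy : y ∈ U
  · exact (hmix y x hy hxy.symm).symm
  · exact hG1 _ _ (fun h => hx (gU' x h)) (fun h => hy (gU' y h)) (hinj.ne hxy.ne)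

lemma exists_equiv_of_isContained {V : Type*} [Finite V] {H G : SimpleGraph V}
    (h : H.IsContained G) : ∃ σ : V ≃ V, ∀ a b, H.Adj a b → G.Adj (σ a) (σ b) := by
  obtain ⟨c⟩ := h
  refine ⟨Equiv.ofBijective c.toHom (Finite.injective_iff_bijective.mp c.injective), ?_⟩
  intro a b hab
  exact c.toHom.map_adj hab

/-! ### Query bounds for subgraph isomorphism -/

open Classical in
/-- The input that describes the graph `G`. -/
noncomputable def inputOfGraph {V : Type*} (G : SimpleGraph V) (e : EdgeVar V) : Bool :=
  decide (e.1 ∈ G.edgeSet)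

lemma graphOfInput_adj {V : Type*} (x : EdgeVar V → Bool) {a b : V} (hab : a ≠ b) :
    (graphOfInput x).Adj a b ↔ x ⟨s(a, b), by simpa using hab⟩ = true := by
  simp [graphOfInput, hab]

lemma graphOfInput_inputOfGraph {V : Type*} (G : SimpleGraph V) :
    graphOfInput (inputOfGraph G) = G := by
  ext a b
  by_cases hab : a = b
  · simp [hab]
  · rw [graphOfInput_adj _ hab]
    simp [inputOfGraph]

lemma subgraphIsoFn_inputOfGraph {V : Type*} (H G : SimpleGraph V) :
    subgraphIsoFn H (inputOfGraph G) = true ↔ H.IsContained G := by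
  simp [subgraphIsoFn, graphOfInput_inputOfGraph]

lemma card_le_two_mul_of_edges {V : Type*} [DecidableEq V] (P : Finset (V × V))
    (hP : ∀ p ∈ P, p.1 ≠ p.2) (T : Finset (EdgeVar V))
    (hT : ∀ p (hp : p ∈ P), (⟨s(p.1, p.2), by simpa using hP p hp⟩ : EdgeVar V) ∈ T) :
    P.card ≤ 2 * T.card := by
  classical
  have h1 : P.card ≤ 2 * (P.image fun p => s(p.1, p.2)).card := by
    refine Finset.card_le_mul_card_image P 2 ?_
    intro e he
    obtain ⟨q, hq, rfl⟩ := Finset.mem_image.mp he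
    have : (P.filter fun p => s(p.1, p.2) = s(q.1, q.2)) ⊆ {q, q.swap} := by
      intro p hp
      have := (Finset.mem_filter.mp hp).2
      rw [Sym2.eq_iff] at this
      simp only [Finset.mem_insert, Finset.mem_singleton, Prod.ext_iff, Prod.fst_swap,
        Prod.snd_swap]
      exact this
    exact (Finset.card_le_card this).trans Finset.card_le_two
  have h2 : (P.image fun p => s(p.1, p.2)) ⊆ T.image Subtype.val := by
    intro e he
    obtain ⟨p, hp, rfl⟩ := Finset.mem_image.mp he
    exact Finset.mem_image.mpr ⟨_, hT p hp, rfl⟩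
  have h3 := (Finset.card_le_card h2).trans Finset.card_image_le
  omega

lemma not_isContained_of_lt {V : Type*} [Finite V] {H G : SimpleGraph V} (h : G < H) :
    ¬ H.IsContained G := by
  classical
  have := Fintype.ofFinite V
  intro hc
  obtain ⟨σ, hσ⟩ := exists_equiv_of_isContained hc
  have h1 : H.edgeFinset.card ≤ G.edgeFinset.card := by
    refine Finset.card_le_card_of_injOn (Sym2.map σ) ?_ (Sym2.map.injective σ.injective).injOn
    intro e
    induction e with
    | _ a b => simpa using hσ a b
  have h2 : G.edgeFinset ⊂ H.edgeFinset := edgeFinset_ssubset_edgeFinset.mpr h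
  exact absurd (Finset.card_lt_card h2) (by omega)

/-- Every set of ordered pairs of vertices in the relation `Q` has at most `W` elements. -/
def PairsAtMost {V : Type*} (Q : V → V → Prop) (W : ℕ) : Prop :=
  ∀ P : Finset (V × V), (∀ p ∈ P, Q p.1 p.2) → P.card ≤ W

lemma PairsAtMost.card_mul_le {V : Type*} {Q : V → V → Prop} {W : ℕ} (hQ : PairsAtMost Q W)
    (s : Finset V) (t : V → Finset V) (k : ℕ) (hk : ∀ a ∈ s, k ≤ (t a).card)
    (ht : ∀ a ∈ s, ∀ c ∈ t a, Q a c) : s.card * k ≤ W := by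
  have h := hQ ((s.sigma t).map (Equiv.sigmaEquivProd V V).toEmbedding) ?_
  · rw [Finset.card_map, Finset.card_sigma] at h
    exact le_trans (by simpa using Finset.card_nsmul_le_sum s _ k hk) h
  · intro p hp
    obtain ⟨⟨a, c⟩, hx, rfl⟩ := Finset.mem_map.mp hp
    rw [Finset.mem_sigma] at hx
    exact ht a hx.1 c hx.2

section Sensitivity

variable {V : Type*} [Fintype V] [DecidableEq V] {H : SimpleGraph V}
  {A : QueryAlgorithm (EdgeVar V)}

/-- Deleting any edge of `H` leaves too few edges for a copy of `H`, so every edge is a sensitive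
variable of the input `H`. -/
lemma card_adj_pairs_le (hA : A.Computes (subgraphIsoFn H)) :
    PairsAtMost H.Adj (2 * (1296 * A.queries ^ 2)) := by
  classical
  intro P hP
  refine (card_le_two_mul_of_edges P (fun p hp => (hP p hp).ne)
    (Finset.univ.filter fun e : EdgeVar V => e.1 ∈ H.edgeSet) ?_).trans
    (Nat.mul_le_mul_left 2 (A.sensitivity_bound hA (inputOfGraph H) _ ?_))
  · intro p hp
    simpa using hP p hp
  · intro e he
    have he' : e.1 ∈ H.edgeSet := by simpa using he
    have hx : inputOfGraph H e = true := by simpa [inputOfGraph] using he'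
    rw [(subgraphIsoFn_inputOfGraph H H).mpr (IsContained.refl H)]
    have hlt : graphOfInput (Function.update (inputOfGraph H) e (!inputOfGraph H e)) < H := by
      rw [hx]
      refine lt_of_le_of_ne ?_ ?_
      · intro a b hab
        have hne := hab.ne
        rw [graphOfInput_adj _ hne] at hab
        by_cases h : (⟨s(a, b), by simpa using hne⟩ : EdgeVar V) = e
        · rw [h] at hab
          simp at hab
        · rw [Function.update_of_ne h] at hab
          simpa [inputOfGraph] using hab
      · intro heq
        obtain ⟨e, hd⟩ := e
        induction e with
        | _ a b =>
          have hab : H.Adj a b := by simpa using he'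
          rw [← heq, graphOfInput_adj _ (by simpa using hd)] at hab
          simp at hab
    have := not_isContained_of_lt hlt
    simpa [subgraphIsoFn] using this

/-- Every `H`-free graph is contained in an `H`-free graph with few non-edges. -/
lemma exists_free_card_nonadj_pairs_le (hA : A.Computes (subgraphIsoFn H)) {G : SimpleGraph V}
    (hG : ¬ H.IsContained G) : ∃ G' ≥ G, ¬ H.IsContained G' ∧
      PairsAtMost (fun a c => a ≠ c ∧ ¬ G'.Adj a c) (2 * (1296 * A.queries ^ 2)) := by
  classical
  -- In a maximal `H`-free graph, adding any missing edge creates `H`, so all non-edges are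
  -- sensitive.
  obtain ⟨G', hle, hmax⟩ :=
    Finite.exists_le_maximal (p := fun G : SimpleGraph V => ¬ H.IsContained G) hG
  refine ⟨G', hle, hmax.prop, fun P hP => ?_⟩
  refine (card_le_two_mul_of_edges P (fun p hp => (hP p hp).1)
    (Finset.univ.filter fun e : EdgeVar V => e.1 ∉ G'.edgeSet) ?_).trans
    (Nat.mul_le_mul_left 2 (A.sensitivity_bound hA (inputOfGraph G') _ ?_))
  · intro p hp
    simpa using (hP p hp).2
  · intro e he
    have he' : e.1 ∉ G'.edgeSet := by simpa using he
    have hx : inputOfGraph G' e = false := by simpa [inputOfGraph] using he'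
    have hf : subgraphIsoFn H (inputOfGraph G') = false := by
      have := hmax.prop
      rw [← subgraphIsoFn_inputOfGraph] at this
      simpa using this
    have hlt : G' < graphOfInput (Function.update (inputOfGraph G') e (!inputOfGraph G' e)) := by
      rw [hx]
      refine lt_of_le_of_ne ?_ ?_
      · intro a b hab
        rw [graphOfInput_adj _ hab.ne]
        by_cases h : (⟨s(a, b), by simpa using hab.ne⟩ : EdgeVar V) = e
        · rw [h]
          simp
        · rw [Function.update_of_ne h]
          simpa [inputOfGraph] using hab
      · intro heq
        obtain ⟨e, hd⟩ := e
        induction e with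
        | _ a b =>
          have hab : ¬ G'.Adj a b := by simpa using he'
          rw [heq, graphOfInput_adj _ (by simpa using hd)] at hab
          simp at hab
    have := hmax.not_prop_of_gt hlt
    rw [hf]
    simpa [subgraphIsoFn] using this

end Sensitivity

/-! ### Independent sets with few neighbors -/

section Neighbors

variable {V : Type*} {H : SimpleGraph V} {W : ℕ}

/-- No two vertices of `U` are adjacent. -/
def IndepFinset (H : SimpleGraph V) (U : Finset V) : Prop := ∀ a ∈ U, ∀ c ∈ U, ¬ H.Adj a c

lemma IndepFinset.subset {U U' : Finset V} (h : IndepFinset H U) (hs : U' ⊆ U) :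
    IndepFinset H U' := fun a ha c hc => h a (hs ha) c (hs hc)

variable [Fintype V]

open Classical in
/-- The vertices with a neighbor in `U`. -/
noncomputable def neighborsOf (H : SimpleGraph V) (U : Finset V) : Finset V :=
  Finset.univ.filter fun c => ∃ a ∈ U, H.Adj a c

lemma mem_neighborsOf {U : Finset V} {c : V} : c ∈ neighborsOf H U ↔ ∃ a ∈ U, H.Adj a c := by
  simp [neighborsOf]

lemma IndepFinset.disjoint {U : Finset V} (h : IndepFinset H U) :
    Disjoint (neighborsOf H U) U := by
  rw [Finset.disjoint_left]
  intro c hc hcU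
  obtain ⟨a, ha, hac⟩ := mem_neighborsOf.mp hc
  exact h a ha c hcU hac

lemma IndepFinset.insert [DecidableEq V] {U : Finset V} (h : IndepFinset H U) {w : V}
    (hw : w ∉ neighborsOf H U) : IndepFinset H (insert w U) := by
  intro a ha c hc hac
  rcases Finset.mem_insert.mp ha with h1 | h1 <;> rcases Finset.mem_insert.mp hc with h2 | h2
  · exact hac.ne (h1.trans h2.symm)
  · exact hw (mem_neighborsOf.mpr ⟨c, h2, h1 ▸ hac.symm⟩)
  · exact hw (mem_neighborsOf.mpr ⟨a, h1, h2 ▸ hac⟩)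
  · exact h a h1 c h2 hac

lemma card_neighborsOf_insert_le [DecidableEq V] (U : Finset V) (w : V) :
    (neighborsOf H (insert w U)).card ≤ (neighborsOf H U).card + (neighborsOf H {w}).card := by
  refine (Finset.card_le_card ?_).trans (Finset.card_union_le _ _)
  intro c hc
  obtain ⟨a, ha, hac⟩ := mem_neighborsOf.mp hc
  rcases Finset.mem_insert.mp ha with rfl | ha
  · exact Finset.mem_union_right _ (mem_neighborsOf.mpr ⟨a, by simp, hac⟩)
  · exact Finset.mem_union_left _ (mem_neighborsOf.mpr ⟨a, ha, hac⟩)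

lemma card_neighborsOf_le {U : Finset V} {D : ℕ}
    (hD : ∀ a ∈ U, (neighborsOf H {a}).card ≤ D) : (neighborsOf H U).card ≤ U.card * D := by
  classical
  refine (Finset.card_le_card ?_).trans (Finset.card_biUnion_le_card_mul U
    (fun a => neighborsOf H {a}) D hD)
  intro c hc
  obtain ⟨a, ha, hac⟩ := mem_neighborsOf.mp hc
  exact Finset.mem_biUnion.mpr ⟨a, ha, mem_neighborsOf.mpr ⟨a, by simp, hac⟩⟩

/-- At least half of the vertices have degree at most `2 W / n`. -/
lemma card_lowDegree (hE : PairsAtMost H.Adj W) [Nonempty V] :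
    Fintype.card V < 2 * (Finset.univ.filter fun v =>
      (neighborsOf H {v}).card ≤ 2 * W / Fintype.card V).card := by
  set n := Fintype.card V with hn
  have hnpos : 0 < n := Fintype.card_pos
  set D := 2 * W / n
  have h1 := hE.card_mul_le (Finset.univ.filter fun v => ¬ (neighborsOf H {v}).card ≤ D)
    (fun v => neighborsOf H {v}) (D + 1) (by
      intro a ha
      have := (Finset.mem_filter.mp ha).2
      omega) (by
      intro a _ c hc
      obtain ⟨a', ha', hac⟩ := mem_neighborsOf.mp hc
      rwa [Finset.mem_singleton.mp ha'] at hac)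
  have h2 := Finset.card_filter_add_card_filter_not (s := (Finset.univ : Finset V))
    (fun v => (neighborsOf H {v}).card ≤ D)
  rw [Finset.card_univ, ← hn] at h2
  have h3 : 2 * W < n * (D + 1) := by
    have := Nat.lt_div_mul_add (a := 2 * W) hnpos
    calc 2 * W < D * n + n := this
      _ = n * (D + 1) := by ring
  set x := (Finset.univ.filter fun v => ¬ (neighborsOf H {v}).card ≤ D).card
  have h4 : 2 * x < n := by
    by_contra hcon
    push Not at hcon
    have := Nat.mul_le_mul_right (D + 1) hcon
    linarith
  omega

/-- A greedy independent set of vertices of low degree. -/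
lemma exists_indep_card_neighborsOf_le (hE : PairsAtMost H.Adj W) [Nonempty V] :
    ∃ U : Finset V, IndepFinset H U ∧ 4 * (neighborsOf H U).card ≤ Fintype.card V ∧
      Fintype.card V < 4 * (2 * W / Fintype.card V + 1) * (U.card + 1) := by
  classical
  have hlow := card_lowDegree hE
  set n := Fintype.card V with hn
  set D := 2 * W / n
  set L := Finset.univ.filter fun v => (neighborsOf H {v}).card ≤ D
  obtain ⟨U, hU, hmax⟩ := Finset.exists_max_image
    (L.powerset.filter fun U => IndepFinset H U) Finset.card
    ⟨∅, Finset.mem_filter.mpr ⟨Finset.empty_mem_powerset L, fun a ha => by simp at ha⟩⟩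
  rw [Finset.mem_filter, Finset.mem_powerset] at hU
  have hdeg : ∀ a ∈ U, (neighborsOf H {a}).card ≤ D := fun a ha =>
    (Finset.mem_filter.mp (hU.1 ha)).2
  have hcover : L ⊆ U ∪ neighborsOf H U := by
    intro w hw
    by_contra hcon
    rw [Finset.mem_union, not_or] at hcon
    have := hmax (insert w U) (Finset.mem_filter.mpr
      ⟨Finset.mem_powerset.mpr (Finset.insert_subset hw hU.1), hU.2.insert hcon.2⟩)
    rw [Finset.card_insert_of_notMem hcon.1] at this
    omega
  have h1 : L.card ≤ U.card * (D + 1) := by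
    have h2 := (Finset.card_le_card hcover).trans (Finset.card_union_le _ _)
    have h3 := card_neighborsOf_le hdeg
    linarith
  -- The set is cut down to this size so that its neighbors, at most `D` per vertex, number at most
  -- n/4.
  have h2 : n / (4 * (D + 1)) ≤ U.card := by
    refine Nat.div_le_of_le_mul ?_
    nlinarith
  obtain ⟨U₁, hU₁, hc⟩ := Finset.exists_subset_card_eq h2
  refine ⟨U₁, hU.2.subset hU₁, ?_, ?_⟩
  · have h3 := card_neighborsOf_le (H := H) (U := U₁) (fun a ha => hdeg a (hU₁ ha))
    have h4 : n / (4 * (D + 1)) * (4 * (D + 1)) ≤ n := Nat.div_mul_le_self _ _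
    rw [← hc] at h4
    nlinarith
  · rw [hc]
    have := Nat.lt_div_mul_add (a := n) (b := 4 * (D + 1)) (by positivity)
    linarith

/-- An independent set with the fewest neighbors among those of its size has a size and a number
of neighbors that are bounded by query complexity. -/
lemma card_mul_card_le_of_minimal_neighborsOf (hE : PairsAtMost H.Adj W)
    (hM : ∀ G : SimpleGraph V, ¬ H.IsContained G → ∃ G' ≥ G, ¬ H.IsContained G' ∧
      PairsAtMost (fun a c => a ≠ c ∧ ¬ G'.Adj a c) W)
    {U : Finset V} (hU : IndepFinset H U) (hne : (neighborsOf H U).Nonempty)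
    (hmin : ∀ U', IndepFinset H U' → U'.card = U.card →
      (neighborsOf H U).card ≤ (neighborsOf H U').card) :
    (neighborsOf H U).card * U.card ≤ 2 * W ∨
      (Fintype.card V - U.card - (neighborsOf H U).card) * U.card ≤ 2 * W := by
  classical
  by_cases hex : ∃ v ∈ neighborsOf H U, 2 * (U.filter (H.Adj v)).card ≤ U.card
  · right
    obtain ⟨v, hv, hy⟩ := hex
    have hdisj := hU.disjoint
    set F := (neighborsOf H U).erase v with hF
    have hFU : Disjoint F U := hdisj.mono_left (Finset.erase_subset _ _)
    let G : SimpleGraph V :=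
      { Adj := fun a c => a ≠ c ∧ (a ∈ U → c ∈ F) ∧ (c ∈ U → a ∈ F)
        symm := ⟨fun a c h => ⟨h.1.symm, h.2.2, h.2.1⟩⟩
        loopless := ⟨fun a h => h.1 rfl⟩ }
    -- A copy of `H` would pull `U` back to an independent set of the same size with at most `|F|`
    -- neighbors, one fewer than the minimum.
    have hfree : ¬ H.IsContained G := by
      intro hc
      obtain ⟨σ, hσ⟩ := exists_equiv_of_isContained hc
      have h1 := hmin (U.map σ.symm.toEmbedding) ?_ (Finset.card_map _)
      · have h2 : (neighborsOf H (U.map σ.symm.toEmbedding)).card ≤ F.card := by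
          refine Finset.card_le_card_of_injOn σ ?_ σ.injective.injOn
          intro c hc
          obtain ⟨a, ha, hac⟩ := mem_neighborsOf.mp hc
          rw [Finset.mem_map_equiv, Equiv.symm_symm] at ha
          exact (hσ a c hac).2.1 ha
        rw [hF, Finset.card_erase_of_mem hv] at h2
        have := Finset.card_pos.mpr hne
        omega
      · intro a ha c hc hac
        rw [Finset.mem_map_equiv, Equiv.symm_symm] at ha hc
        exact Finset.disjoint_left.mp hFU ((hσ a c hac).2.1 ha) hc
    obtain ⟨G', hle, hfree', hpairs⟩ := hM G hfree
    -- Otherwise `b` could play the role of `v`. Hence each such `b` misses at least half of `U`.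
    have hrow : ∀ b ∈ Finset.univ \ (U ∪ F),
        (U.filter (G'.Adj b)).card < (U.filter (H.Adj v)).card := by
      intro b hb
      simp only [Finset.mem_sdiff, Finset.mem_univ, true_and, Finset.mem_union, not_or] at hb
      by_contra hcon
      refine hfree' (isContained_of_complete_outside (U := U) (U' := U) (F := F) (F' := F)
        (v := v) (b := b) rfl (Finset.disjoint_left.mp hdisj hv) (Finset.notMem_erase v _) hFU
        ?_ le_rfl hb.1 hb.2 hFU ?_ ?_ (not_lt.mp hcon))
      · intro a ha c hac
        by_cases hcv : c = v
        · exact Or.inl hcv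
        · exact Or.inr (Finset.mem_erase.mpr ⟨hcv, mem_neighborsOf.mpr ⟨a, ha, hac⟩⟩)
      · intro a c ha hc hac
        exact hle ⟨hac, fun h => absurd h ha, fun h => absurd h hc⟩
      · intro a ha c hc
        have haU := Finset.disjoint_left.mp hFU ha
        exact hle ⟨fun h => haU (h ▸ hc), fun h => absurd h haU, fun _ => ha⟩
    have hmul := hpairs.card_mul_le (Finset.univ \ (U ∪ F))
      (fun b => U.filter fun c => ¬ G'.Adj b c) (U.card - (U.filter (H.Adj v)).card) (by
        intro b hb
        have h1 := hrow b hb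
        have h2 := Finset.card_filter_add_card_filter_not (s := U) (G'.Adj b)
        omega) (by
        intro b hb c hc
        rw [Finset.mem_filter] at hc
        simp only [Finset.mem_sdiff, Finset.mem_union, not_or] at hb
        exact ⟨fun h => hb.2.1 (h ▸ hc.1), hc.2⟩)
    have hcard : Fintype.card V - U.card - (neighborsOf H U).card ≤
        (Finset.univ \ (U ∪ F)).card := by
      rw [Finset.card_sdiff_of_subset (Finset.subset_univ _), Finset.card_univ]
      have h1 := Finset.card_union_le U F
      have h2 : F.card ≤ (neighborsOf H U).card := Finset.card_erase_le
      omega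
    calc _ ≤ (Finset.univ \ (U ∪ F)).card * (2 * (U.card - (U.filter (H.Adj v)).card)) :=
          Nat.mul_le_mul hcard (by omega)
      _ ≤ 2 * W := by linarith
  · left
    push Not at hex
    have hmul := hE.card_mul_le (neighborsOf H U) (fun v => U.filter (H.Adj v))
      ((U.card + 1) / 2) (fun v hv => by have := hex v hv; omega)
      (fun v _ c hc => (Finset.mem_filter.mp hc).2)
    calc _ ≤ (neighborsOf H U).card * (2 * ((U.card + 1) / 2)) :=
          Nat.mul_le_mul_left _ (by omega)
      _ ≤ 2 * W := by linarith

/-- Either the query complexity is large or a quarter of the vertices are independent. -/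
lemma exists_large_indep (hE : PairsAtMost H.Adj W)
    (hM : ∀ G : SimpleGraph V, ¬ H.IsContained G → ∃ G' ≥ G, ¬ H.IsContained G' ∧
      PairsAtMost (fun a c => a ≠ c ∧ ¬ G'.Adj a c) W)
    [Nonempty V] : Fintype.card V ^ 3 ≤ 2304 * W ^ 2 ∨
      ∃ S : Finset V, IndepFinset H S ∧ Fintype.card V ≤ 4 * S.card := by
  classical
  have hlow := card_lowDegree hE
  obtain ⟨U₁, hU₁, hN₁, hc₁⟩ := exists_indep_card_neighborsOf_le hE
  set n := Fintype.card V with hn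
  have hnpos : 0 < n := Fintype.card_pos
  set D := 2 * W / n
  have hDn : D * n ≤ 2 * W := Nat.div_mul_le_self _ _
  by_cases hD : n ≤ 8 * D
  · left
    have h1 : n ^ 2 ≤ 16 * W := by nlinarith
    calc n ^ 3 ≤ n ^ 4 := Nat.pow_le_pow_right hnpos (by norm_num)
      _ = (n ^ 2) ^ 2 := by ring
      _ ≤ (16 * W) ^ 2 := Nat.pow_le_pow_left h1 2
      _ ≤ 2304 * W ^ 2 := by nlinarith [sq_nonneg W]
  rw [or_iff_not_imp_right]
  intro hno
  push Not at hno hD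
  obtain ⟨U₂, hU₂, hmax⟩ := Finset.exists_max_image
    (Finset.univ.filter fun U => IndepFinset H U ∧ 4 * (neighborsOf H U).card ≤ n) Finset.card
    ⟨U₁, by simp [hU₁, hN₁]⟩
  simp only [Finset.mem_filter, Finset.mem_univ, true_and] at hU₂ hmax
  obtain ⟨U, hU, hmin⟩ := Finset.exists_min_image
    (Finset.univ.filter fun U => IndepFinset H U ∧ U.card = U₂.card)
    (fun U => (neighborsOf H U).card) ⟨U₂, by simp [hU₂.1]⟩
  simp only [Finset.mem_filter, Finset.mem_univ, true_and] at hU hmin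
  have hN : 4 * (neighborsOf H U).card ≤ n := by
    have := hmin U₂ ⟨hU₂.1, rfl⟩
    omega
  have hUn : 4 * U.card < n := hno U hU.1
  have hle₁ : U₁.card ≤ U.card := hU.2 ▸ hmax U₁ ⟨hU₁, hN₁⟩
  -- More than n/2 vertices have low degree, while `U` and its neighbors fill at most n/2. By
  -- maximality of the size, adding `w` brings the neighbors above n/4, so `U` already has more than
  -- n/4 - D > n/8.
  obtain ⟨w, hw, hw'⟩ : ∃ w ∈ Finset.univ.filter fun v => (neighborsOf H {v}).card ≤ D,
      w ∉ U ∪ neighborsOf H U := by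
    refine Finset.exists_mem_notMem_of_card_lt_card ?_
    have := Finset.card_union_le U (neighborsOf H U)
    omega
  rw [Finset.mem_union, not_or] at hw'
  have hwD := (Finset.mem_filter.mp hw).2
  have hbig : n < 4 * (neighborsOf H (insert w U)).card := by
    by_contra hcon
    have := hmax (insert w U) ⟨hU.1.insert hw'.2, not_lt.mp hcon⟩
    rw [Finset.card_insert_of_notMem hw'.1] at this
    omega
  have hins := card_neighborsOf_insert_le (H := H) U w
  have hh : n < 8 * (neighborsOf H U).card := by omega
  have hne : (neighborsOf H U).Nonempty := Finset.card_pos.mp (by omega)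
  have hupos : 0 < U.card := by
    obtain ⟨c, hc⟩ := hne
    obtain ⟨a, ha, -⟩ := mem_neighborsOf.mp hc
    exact Finset.card_pos.mpr ⟨a, ha⟩
  have hnu : n * U.card ≤ 16 * W := by
    rcases card_mul_card_le_of_minimal_neighborsOf hE hM hU.1 hne
      (fun U' h h' => hmin U' ⟨h, h'.trans hU.2⟩) with h | h
    · have := Nat.mul_le_mul_right U.card hh.le
      linarith
    · have h2 : n ≤ 2 * (n - U.card - (neighborsOf H U).card) := by omega
      have := Nat.mul_le_mul_right U.card h2
      linarith
  have h1 : n ≤ 8 * (D + 1) * U.card := by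
    have : 4 * (D + 1) * (U₁.card + 1) ≤ 4 * (D + 1) * (2 * U.card) :=
      Nat.mul_le_mul_left _ (by omega)
    linarith
  have h2 : n ≤ 16 * W := le_trans (Nat.le_mul_of_pos_right n hupos) hnu
  calc n ^ 3 = n * n * n := by ring
    _ ≤ n * n * (8 * (D + 1) * U.card) := Nat.mul_le_mul_left _ h1
    _ = 8 * (D * n + n) * (n * U.card) := by ring
    _ ≤ 8 * (2 * W + 16 * W) * (16 * W) := by gcongr
    _ = 2304 * W ^ 2 := by ring

end Neighbors

/-! ### Graphs that are complete outside a set larger than every independent set -/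

section LargeIndep

variable {V : Type*} [Fintype V] [DecidableEq V] {H : SimpleGraph V} {W : ℕ}

open Classical in
/-- A graph in which every two vertices not both in `B` are adjacent contains `H` if some vertex
of `B` has many neighbors in `B`. -/
lemma isContained_of_row {S B : Finset V} {v b : V} (hS : IndepFinset H S) (hv : v ∉ S)
    (hB : B.card = S.card + 1) (hb : b ∈ B) {G : SimpleGraph V}
    (hG : ∀ a c, a ≠ c → a ∉ B → G.Adj a c)
    (hrow : (S.filter (H.Adj v)).card ≤ ((B.erase b).filter (G.Adj b)).card) :
    H.IsContained G := by
  have hbc : (B.erase b).card = S.card := by rw [Finset.card_erase_of_mem hb, hB]; rfl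
  refine isContained_of_complete_outside (U := S) (U' := B.erase b) (F := (insert v S)ᶜ)
    (F' := Bᶜ) hbc.symm hv (by simp) ?_ ?_ ?_ (Finset.notMem_erase b B) (by simpa using hb) ?_
    ?_ ?_ hrow
  · rw [Finset.disjoint_left]
    intro a ha haS
    simp [haS] at ha
  · intro a ha c hac
    by_cases hc : c = v
    · exact Or.inl hc
    · refine Or.inr ?_
      rw [Finset.mem_compl, Finset.mem_insert, not_or]
      exact ⟨hc, fun h => hS a ha c h hac⟩
  · rw [Finset.card_compl, Finset.card_compl, hB, Finset.card_insert_of_notMem hv]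
  · rw [Finset.disjoint_left]
    intro a ha haB
    exact Finset.mem_compl.mp ha (Finset.mem_of_mem_erase haB)
  · intro a c ha hc hac
    by_cases haB : a ∈ B
    · have hab : a = b := by
        by_contra h
        exact ha (Finset.mem_erase.mpr ⟨h, haB⟩)
      refine (hG c a hac.symm fun hcB => ?_).symm
      have hcb : c = b := by
        by_contra h
        exact hc (Finset.mem_erase.mpr ⟨h, hcB⟩)
      exact hac (hab.trans hcb.symm)
    · exact hG a c hac haB
  · intro a ha c hc
    rw [Finset.mem_compl] at ha
    exact hG a c (fun h => ha (h ▸ Finset.mem_of_mem_erase hc)) ha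

open Classical in
-- The graph missing exactly the edges inside `insert v S` is `H`-free, as a copy would give an
-- independent set larger than `S`. In an `H`-free extension no vertex of that set can have as many
-- neighbors inside it as `v` has in `S`.
lemma card_mul_le_of_max_indep
    (hM : ∀ G : SimpleGraph V, ¬ H.IsContained G → ∃ G' ≥ G, ¬ H.IsContained G' ∧
      PairsAtMost (fun a c => a ≠ c ∧ ¬ G'.Adj a c) W)
    {S : Finset V} {v : V} (hS : IndepFinset H S) (hv : v ∉ S)
    (hmax : ∀ U, IndepFinset H U → U.card ≤ S.card) :
    (S.card + 1) * (S.card + 1 - (S.filter (H.Adj v)).card) ≤ W := by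
  set B := insert v S with hB
  have hBc : B.card = S.card + 1 := Finset.card_insert_of_notMem hv
  let G : SimpleGraph V :=
    { Adj := fun a c => a ≠ c ∧ (a ∉ B ∨ c ∉ B)
      symm := ⟨fun a c h => ⟨h.1.symm, h.2.symm⟩⟩
      loopless := ⟨fun a h => h.1 rfl⟩ }
  have hfree : ¬ H.IsContained G := by
    intro hc
    obtain ⟨σ, hσ⟩ := exists_equiv_of_isContained hc
    have := hmax (B.map σ.symm.toEmbedding) ?_
    · rw [Finset.card_map, hBc] at this
      omega
    · intro a ha c hc hac
      rw [Finset.mem_map_equiv, Equiv.symm_symm] at ha hc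
      rcases (hσ a c hac).2 with h | h
      · exact h ha
      · exact h hc
  obtain ⟨G', hle, hfree', hpairs⟩ := hM G hfree
  rw [← hBc]
  refine hpairs.card_mul_le B (fun b => (B.erase b).filter fun c => ¬ G'.Adj b c) _ ?_ ?_
  · intro b hb
    have h1 : ¬ (S.filter (H.Adj v)).card ≤ ((B.erase b).filter (G'.Adj b)).card := fun h =>
      hfree' (isContained_of_row hS hv hBc hb (fun a c hac ha => hle ⟨hac, Or.inl ha⟩) h)
    have h2 := Finset.card_filter_add_card_filter_not (s := B.erase b) (G'.Adj b)
    rw [Finset.card_erase_of_mem hb] at h2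
    omega
  · intro b _ c hc
    rw [Finset.mem_filter, Finset.mem_erase] at hc
    exact ⟨fun h => hc.1.1 h.symm, hc.2⟩

open Classical in
/-- If every vertex outside the independent set `S` has at least `t` neighbors in `S`, then a
graph contains no copy of `H` unless some vertex of `B` has more than `t - |V ∖ S|` neighbors
in `B`. -/
lemma not_isContained_of_rows {S B : Finset V} {t : ℕ} (hB : S.card < B.card)
    (ht : ∀ v, v ∉ S → t ≤ (S.filter (H.Adj v)).card) {G : SimpleGraph V}
    (hG : ∀ b ∈ B, (B.filter (G.Adj b)).card + (Fintype.card V - S.card) ≤ t) :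
    ¬ H.IsContained G := by
  intro hc
  obtain ⟨σ, hσ⟩ := exists_equiv_of_isContained hc
  set R := B.map σ.symm.toEmbedding with hR
  have hRc : R.card = B.card := Finset.card_map _
  have hmem : ∀ a, a ∈ R ↔ σ a ∈ B := fun a => by
    rw [hR, Finset.mem_map_equiv, Equiv.symm_symm]
  -- The preimage `R` of `B` is larger than `S`, so it holds a vertex outside `S`; at most `|V| -
  -- |R|` of that vertex's neighbors in `S` lie outside `R`.
  obtain ⟨v, hvR, hvS⟩ := Finset.exists_mem_notMem_of_card_lt_card (hRc ▸ hB : S.card < R.card)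
  have h1 := ht v hvS
  have h2 : (S.filter (H.Adj v)).card ≤ (R.filter (H.Adj v)).card + (S \ R).card := by
    refine (Finset.card_le_card ?_).trans (Finset.card_union_le _ _)
    intro a ha
    rw [Finset.mem_filter] at ha
    rw [Finset.mem_union, Finset.mem_filter, Finset.mem_sdiff]
    by_cases haR : a ∈ R
    · exact Or.inl ⟨haR, ha.2⟩
    · exact Or.inr ⟨ha.1, haR⟩
  have h3 : (R.filter (H.Adj v)).card ≤ (B.filter (G.Adj (σ v))).card := by
    refine Finset.card_le_card_of_injOn σ ?_ σ.injective.injOn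
    intro a ha
    have ha' := Finset.mem_filter.mp ha
    exact Finset.mem_coe.mpr (Finset.mem_filter.mpr ⟨(hmem a).mp ha'.1, hσ v a ha'.2⟩)
  have h4 : (S \ R).card + R.card ≤ Fintype.card V := by
    rw [Finset.card_sdiff_add_card]
    exact Finset.card_le_univ _
  have h5 := hG (σ v) ((hmem v).mp hvR)
  omega

end LargeIndep

/-! ### Stars with a block of missing edges -/

section Blocks

variable {V : Type*} {l w p : ℕ}

/-- The vertex `a` is the `i`-th row for some `i`, and `c` is not in the block that is missing
from this row. -/
def RowAdj (e : Fin l ⊕ (Fin w × Fin p) → V) (g : Fin l → Option (Fin w)) (a c : V) : Prop :=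
  ∃ i, a = e (Sum.inl i) ∧ ∀ j q, g i = some j → c ≠ e (Sum.inr (j, q))

/-- All edges except those inside `B`, together with all edges at the vertices of the rows except
those to the missing blocks. -/
def blockGraph (B : Finset V) (e : Fin l ⊕ (Fin w × Fin p) → V) (g : Fin l → Option (Fin w)) :
    SimpleGraph V where
  Adj a c := a ≠ c ∧ (a ∉ B ∨ c ∉ B ∨ RowAdj e g a c ∨ RowAdj e g c a)
  symm := ⟨fun a c h => ⟨h.1.symm, by tauto⟩⟩
  loopless := ⟨fun a h => h.1 rfl⟩

lemma RowAdj.mono {e : Fin l ⊕ (Fin w × Fin p) → V} {g g' : Fin l → Option (Fin w)} {i₀ : Fin l}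
    (hg : g i₀ = none) (hgg' : ∀ i, i ≠ i₀ → g i = g' i) {a c : V} (h : RowAdj e g' a c) :
    RowAdj e g a c := by
  obtain ⟨i, rfl, hi⟩ := h
  refine ⟨i, rfl, fun j q hj => hi j q ?_⟩
  rw [← hgg' i, hj]
  rintro rfl
  rw [hg] at hj
  cases hj

lemma exists_eq_of_rowAdj {e : Fin l ⊕ (Fin w × Fin p) → V} {g g' : Fin l → Option (Fin w)}
    {i₀ : Fin l} {j : Fin w} (hg' : g' i₀ = some j) (hgg' : ∀ i, i ≠ i₀ → g i = g' i) {a c : V}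
    (h : RowAdj e g a c) (h' : ¬ RowAdj e g' a c) :
    ∃ q, s(a, c) = s(e (Sum.inl i₀), e (Sum.inr (j, q))) := by
  obtain ⟨i, rfl, hi⟩ := h
  unfold RowAdj at h'
  push Not at h'
  obtain ⟨j', q, hj', rfl⟩ := h' i rfl
  have hii : i = i₀ := by
    by_contra hne
    exact hi j' q (by rw [hgg' i hne, hj']) rfl
  subst hii
  rw [hg'] at hj'
  cases hj'
  exact ⟨q, rfl⟩

/-- A differing variable thus reveals both the row and its missing block, which is what makes the
adversary relation injective at each variable. -/
lemma exists_eq_of_inputOfGraph_ne {B : Finset V} {e : Fin l ⊕ (Fin w × Fin p) → V}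
    {g g' : Fin l → Option (Fin w)} {i₀ : Fin l} {j : Fin w} (hg : g i₀ = none)
    (hg' : g' i₀ = some j) (hgg' : ∀ i, i ≠ i₀ → g i = g' i) {ε : EdgeVar V}
    (h : inputOfGraph (blockGraph B e g) ε ≠ inputOfGraph (blockGraph B e g') ε) :
    ∃ q, ε.1 = s(e (Sum.inl i₀), e (Sum.inr (j, q))) := by
  obtain ⟨ε, hε⟩ := ε
  induction ε with
  | _ a c =>
    simp only [inputOfGraph, mem_edgeSet, ne_eq, decide_eq_decide] at h
    simp only [blockGraph] at h
    by_cases h1 : RowAdj e g a c ∧ ¬ RowAdj e g' a c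
    · exact exists_eq_of_rowAdj hg' hgg' h1.1 h1.2
    by_cases h2 : RowAdj e g c a ∧ ¬ RowAdj e g' c a
    · obtain ⟨q, hq⟩ := exists_eq_of_rowAdj hg' hgg' h2.1 h2.2
      exact ⟨q, Sym2.eq_swap.trans hq⟩
    have h3 : RowAdj e g a c ↔ RowAdj e g' a c :=
      ⟨fun hr => not_not.mp fun hn => h1 ⟨hr, hn⟩, RowAdj.mono hg hgg'⟩
    have h4 : RowAdj e g c a ↔ RowAdj e g' c a :=
      ⟨fun hr => not_not.mp fun hn => h2 ⟨hr, hn⟩, RowAdj.mono hg hgg'⟩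
    rw [h3, h4] at h
    exact absurd Iff.rfl h

variable [DecidableEq V]

open Classical in
-- A row vertex misses itself and its block of `p`; any other vertex of `B` is joined within `B`
-- only to the `l` rows.
lemma card_filter_blockGraph_le {B : Finset V} {e : Fin l ⊕ (Fin w × Fin p) → V}
    (he : Function.Injective e) (heB : ∀ z, e z ∈ B) (hp : l + p + 1 ≤ B.card)
    (g : Fin l → Fin w) {b : V} (hb : b ∈ B) :
    (B.filter ((blockGraph B e fun i => some (g i)).Adj b)).card + p + 1 ≤ B.card := by
  suffices h : ∃ T ⊆ B, p + 1 ≤ T.card ∧ ∀ c ∈ T,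
      ¬ (blockGraph B e fun i => some (g i)).Adj b c by
    obtain ⟨T, hTB, hT, hadj⟩ := h
    have h1 : B.filter ((blockGraph B e fun i => some (g i)).Adj b) ⊆ B \ T := by
      intro c hc
      rw [Finset.mem_filter] at hc
      exact Finset.mem_sdiff.mpr ⟨hc.1, fun h => hadj c h hc.2⟩
    have h2 := Finset.card_le_card h1
    rw [Finset.card_sdiff_of_subset hTB] at h2
    have := Finset.card_le_card hTB
    omega
  by_cases hrow : ∃ i, b = e (Sum.inl i)
  · obtain ⟨i, rfl⟩ := hrow
    refine ⟨insert (e (Sum.inl i)) (Finset.univ.image fun q => e (Sum.inr (g i, q))), ?_, ?_, ?_⟩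
    · refine Finset.insert_subset hb ?_
      intro c hc
      obtain ⟨q, -, rfl⟩ := Finset.mem_image.mp hc
      exact heB _
    · rw [Finset.card_insert_of_notMem, Finset.card_image_of_injective, Finset.card_univ,
        Fintype.card_fin]
      · intro q q' h
        simpa using he h
      · intro h
        obtain ⟨q, -, hq⟩ := Finset.mem_image.mp h
        simpa using he hq
    · intro c hc hadj
      rcases Finset.mem_insert.mp hc with rfl | hc
      · exact hadj.ne rfl
      obtain ⟨q, -, rfl⟩ := Finset.mem_image.mp hc
      rcases hadj.2 with h | h | ⟨i', hi', h⟩ | ⟨i', hi', -⟩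
      · exact h hb
      · exact h (heB _)
      · obtain rfl : i = i' := by simpa using he hi'
        exact h (g i) q rfl rfl
      · simpa using he hi'
  · refine ⟨B \ Finset.univ.image fun i => e (Sum.inl i), Finset.sdiff_subset, ?_, ?_⟩
    · have h1 : (Finset.univ.image fun i => e (Sum.inl i)).card ≤ l :=
        Finset.card_image_le.trans (by simp)
      have h2 := Finset.le_card_sdiff (Finset.univ.image fun i => e (Sum.inl i)) B
      omega
    · intro c hc hadj
      rw [Finset.mem_sdiff] at hc
      rcases hadj.2 with h | h | ⟨i, hi, -⟩ | ⟨i, hi, -⟩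
      · exact h hb
      · exact h hc.1
      · exact hrow ⟨i, hi⟩
      · exact hc.2 (Finset.mem_image.mpr ⟨i, Finset.mem_univ _, hi.symm⟩)

variable [Fintype V]

open Classical in
/-- The adversary bound for distinguishing graphs in which every row misses a block from those in
which one row misses nothing. -/
lemma mul_le_of_blocks {H : SimpleGraph V} {A : QueryAlgorithm (EdgeVar V)}
    (hA : A.Computes (subgraphIsoFn H)) {S B : Finset V} {v : V} {t : ℕ}
    (hS : IndepFinset H S) (hv : v ∉ S) (hB : B.card = S.card + 1)
    (ht : ∀ v, v ∉ S → t ≤ (S.filter (H.Adj v)).card)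
    (hpt : Fintype.card V ≤ t + p) (hlw : l + w * p ≤ B.card)
    (hlp : l + p + 1 ≤ B.card) : l * w ≤ 1296 * A.queries ^ 2 := by
  rcases Nat.eq_zero_or_pos l with rfl | hl
  · simp
  rcases Nat.eq_zero_or_pos w with rfl | hw
  · simp
  have : NeZero l := ⟨hl.ne'⟩
  have : NeZero w := ⟨hw.ne'⟩
  obtain ⟨e₀⟩ : Nonempty (Fin l ⊕ (Fin w × Fin p) ↪ B) :=
    Function.Embedding.nonempty_of_card_le (by simpa using hlw)
  set e : Fin l ⊕ (Fin w × Fin p) → V := fun z => e₀ z 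
  have he : Function.Injective e := Subtype.val_injective.comp e₀.injective
  have heB : ∀ z, e z ∈ B := fun z => (e₀ z).2
  -- The full row has no block; setting its unused entry to `0` gives each choice of full row and
  -- remaining blocks a single index.
  let α := {x : Fin l × (Fin l → Fin w) // x.2 x.1 = 0}
  have : Nonempty α := ⟨⟨(0, fun _ => 0), rfl⟩⟩
  let ga : α → Fin l → Option (Fin w) := fun a i => if i = a.1.1 then none else some (a.1.2 i)
  have hdiff : ∀ (a : α) (b : Fin l → Fin w), (∀ i, i ≠ a.1.1 → a.1.2 i = b i) →
      ∀ ε, inputOfGraph (blockGraph B e (ga a)) ε ≠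
        inputOfGraph (blockGraph B e fun i => some (b i)) ε →
      ∃ q, ε.1 = s(e (Sum.inl a.1.1), e (Sum.inr (b a.1.1, q))) := by
    intro a b hab ε hε
    refine exists_eq_of_inputOfGraph_ne (g := ga a) (g' := fun i => some (b i)) (i₀ := a.1.1)
      (if_pos rfl) rfl ?_ hε
    intro i hi
    simp [ga, hi, hab i hi]
  rw [mul_comm]
  refine A.adversary_bound hA (α := α) (β := Fin l → Fin w)
    (fun a => inputOfGraph (blockGraph B e (ga a)))
    (fun b => inputOfGraph (blockGraph B e fun i => some (b i)))
    (fun a b => ∀ i, i ≠ a.1.1 → a.1.2 i = b i) ?_ ?_ ?_ ?_ ?_ ?_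
  · intro a
    rw [subgraphIsoFn_inputOfGraph]
    refine isContained_of_row hS hv hB (heB (Sum.inl a.1.1)) ?_ ?_
    · intro x y hxy hx
      exact ⟨hxy, Or.inl hx⟩
    · rw [Finset.filter_true_of_mem (s := B.erase _), Finset.card_erase_of_mem (heB _), hB]
      · exact Finset.card_filter_le _ _
      · intro c hc
        refine ⟨fun h => Finset.ne_of_mem_erase hc h.symm, Or.inr (Or.inr (Or.inl
          ⟨a.1.1, rfl, fun j q hj => ?_⟩))⟩
        simp [ga] at hj
  · intro b
    rw [← Bool.not_eq_true, subgraphIsoFn_inputOfGraph]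
    refine not_isContained_of_rows (S := S) (B := B) (by omega) ht fun c hc => ?_
    have h1 := card_filter_blockGraph_le he heB hlp b hc
    have h2 : S.card ≤ Fintype.card V := Finset.card_le_univ S
    omega
  · intro a
    have h := Finset.card_le_card_of_injOn (s := (Finset.univ : Finset (Fin w)))
      (t := Finset.univ.filter fun b : Fin l → Fin w => ∀ i, i ≠ a.1.1 → a.1.2 i = b i)
      (fun c => Function.update a.1.2 a.1.1 c) ?_ ?_
    · simpa using h
    · intro c _
      refine Finset.mem_coe.mpr (Finset.mem_filter.mpr ⟨Finset.mem_univ _, ?_⟩)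
      intro i hi
      exact (Function.update_of_ne hi _ _).symm
    · intro c _ c' _ h
      simpa using congrFun h a.1.1
  · intro b
    have h := Finset.card_le_card_of_injOn (s := (Finset.univ : Finset (Fin l)))
      (t := Finset.univ.filter fun a : α => ∀ i, i ≠ a.1.1 → a.1.2 i = b i)
      (fun i => ⟨(i, Function.update b i 0), by simp⟩) ?_ ?_
    · simpa using h
    · intro i _
      refine Finset.mem_coe.mpr (Finset.mem_filter.mpr ⟨Finset.mem_univ _, ?_⟩)
      intro i' hi'
      exact Function.update_of_ne hi' _ _
    · intro i _ i' _ h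
      exact congrArg (fun a : α => a.1.1) h
  · intro a ε b b' hb hb' hne hne'
    obtain ⟨q, hq⟩ := hdiff a b hb ε hne
    obtain ⟨q', hq'⟩ := hdiff a b' hb' ε hne'
    rw [hq, Sym2.eq_iff] at hq'
    funext i
    by_cases hi : i = a.1.1
    · subst hi
      rcases hq' with ⟨-, h⟩ | ⟨h, -⟩
      · have := he h
        simp only [Sum.inr.injEq, Prod.mk.injEq] at this
        exact this.1
      · exact absurd (he h) (by simp)
    · rw [← hb i hi, ← hb' i hi]
  · intro b ε a a' ha ha' hne hne'
    obtain ⟨q, hq⟩ := hdiff a b ha ε hne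
    obtain ⟨q', hq'⟩ := hdiff a' b ha' ε hne'
    rw [hq, Sym2.eq_iff] at hq'
    have h1 : a.1.1 = a'.1.1 := by
      rcases hq' with ⟨h, -⟩ | ⟨h, -⟩
      · simpa using he h
      · exact absurd (he h) (by simp)
    refine Subtype.ext (Prod.ext h1 ?_)
    funext i
    by_cases hi : i = a.1.1
    · rw [hi, a.2, h1, a'.2]
    · rw [ha i hi, ha' i (h1 ▸ hi)]

end Blocks

/-! ### The lower bound -/

/-- If a quarter of the vertices are independent in `H`, the query complexity is large. -/
lemma card_pow_three_le_of_indep {V : Type*} [Fintype V] [DecidableEq V] {H : SimpleGraph V}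
    (hH : H ≠ ⊥) {A : QueryAlgorithm (EdgeVar V)} (hA : A.Computes (subgraphIsoFn H))
    {S₁ : Finset V} (hS₁ : IndepFinset H S₁) (hc : Fintype.card V ≤ 4 * S₁.card) :
    Fintype.card V ^ 3 ≤ 9216 * (2 * (1296 * A.queries ^ 2)) ^ 2 := by
  classical
  obtain ⟨S₀, hS₀, hmax⟩ := Finset.exists_max_image
    (Finset.univ.filter fun U => IndepFinset H U) Finset.card ⟨S₁, by simpa using hS₁⟩
  simp only [Finset.mem_filter, Finset.mem_univ, true_and] at hS₀ hmax
  have hout : ∀ S : Finset V, IndepFinset H S → ∃ v, v ∉ S := by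
    intro S hS
    by_contra hcon
    push Not at hcon
    refine hH (eq_bot_iff.mpr fun a c hac => ?_)
    exact hS a (hcon a) c (hcon c) hac
  obtain ⟨v₀, hv₀⟩ := hout S₀ hS₀
  obtain ⟨⟨S, v⟩, hSv, hmin⟩ := Finset.exists_min_image
    (Finset.univ.filter fun x : Finset V × V =>
      IndepFinset H x.1 ∧ x.1.card = S₀.card ∧ x.2 ∉ x.1)
    (fun x => (x.1.filter (H.Adj x.2)).card) ⟨(S₀, v₀), by simp [hS₀, hv₀]⟩
  simp only [Finset.mem_filter, Finset.mem_univ, true_and] at hSv hmin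
  obtain ⟨hS, hSc, hv⟩ := hSv
  set t := (S.filter (H.Adj v)).card with ht
  have htv : ∀ v', v' ∉ S → t ≤ (S.filter (H.Adj v')).card := fun v' hv' =>
    hmin (S, v') ⟨hS, hSc, hv'⟩
  have hBc : (insert v S).card = S.card + 1 := Finset.card_insert_of_notMem hv
  have h1 := card_mul_le_of_max_indep (fun G hG => exists_free_card_nonadj_pairs_le hA hG) hS hv
    (fun U hU => hSc ▸ hmax U hU)
  have h2 := (card_adj_pairs_le hA).card_mul_le Sᶜ (fun v' => S.filter (H.Adj v')) t
    (fun v' hv' => htv v' (Finset.mem_compl.mp hv')) (fun _ _ c hc => (Finset.mem_filter.mp hc).2)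
  rw [Finset.card_compl] at h2
  have h3 : ∀ l w p : ℕ, Fintype.card V ≤ t + p → l + w * p ≤ S.card + 1 →
      l + p + 1 ≤ S.card + 1 → l * w ≤ 2 * (1296 * A.queries ^ 2) := by
    intro l w p hp hlw hlp
    have := mul_le_of_blocks hA hS hv hBc htv hp (hBc ▸ hlw) (hBc ▸ hlp)
    omega
  have h4 : Fintype.card V ≤ 4 * (S.card + 1) := by
    have := hmax S₁ hS₁
    omega
  have h5 : t ≤ S.card := Finset.card_filter_le _ _
  have h6 : S.card + 1 ≤ Fintype.card V := hBc ▸ Finset.card_le_univ (insert v S)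
  rw [← ht] at h1
  generalize 2 * (1296 * A.queries ^ 2) = W at *
  generalize Fintype.card V = n at *
  obtain ⟨k, rfl⟩ := Nat.exists_eq_add_of_le h6
  obtain ⟨d, hd⟩ := Nat.exists_eq_add_of_le h5
  set N := S.card + 1 with hN
  have hNt : N - t = d + 1 := by omega
  have hk : N + k - S.card = k + 1 := by omega
  rw [hNt] at h1
  rw [hk] at h2
  suffices h : N ^ 3 ≤ 144 * W ^ 2 by
    calc (N + k) ^ 3 ≤ (4 * N) ^ 3 := Nat.pow_le_pow_left h4 3
      _ = 64 * N ^ 3 := by ring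
      _ ≤ 9216 * W ^ 2 := by omega
  have hsq : N ^ 2 ≤ 12 * W → N ^ 3 ≤ 144 * W ^ 2 := by
    intro h
    calc N ^ 3 ≤ N ^ 4 := Nat.pow_le_pow_right (by omega) (by norm_num)
      _ = (N ^ 2) ^ 2 := by ring
      _ ≤ (12 * W) ^ 2 := Nat.pow_le_pow_left h 2
      _ = 144 * W ^ 2 := by ring
  by_cases h2t : 2 * t < N
  · refine hsq ?_
    have : N ≤ 2 * (d + 1) := by omega
    nlinarith [Nat.mul_le_mul_left N this]
  push Not at h2t
  -- This is `n - t`, the least block length that makes the blocked graphs `H`-free. Its two parts,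
  -- N - t and n - N, are each controlled by one sensitivity bound.
  set p := d + 1 + k with hp
  have hpN : p * N ≤ 3 * W := by
    have := Nat.mul_le_mul_left (k + 1) h2t
    nlinarith
  by_cases h4p : N < 4 * p
  · refine hsq ?_
    nlinarith
  push Not at h4p
  have hw1 : N / (2 * p) * (2 * p) ≤ N := Nat.div_mul_le_self _ _
  have hw2 : N < N / (2 * p) * (2 * p) + 2 * p := Nat.lt_div_mul_add (by omega)
  -- Half of `B` serves as rows, the other half is cut into blocks of length `p`; `4 * p ≤ N` leaves
  -- the room needed for both size conditions.
  have h7 := h3 (N / 2) (N / (2 * p)) p (by omega) (by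
    have : N / (2 * p) * p ≤ N / 2 := by
      rw [Nat.le_div_iff_mul_le (by norm_num)]
      linarith
    omega) (by omega)
  set w := N / (2 * p)
  have h8 : N ≤ 4 * (N / 2) := by omega
  have h9 : N ≤ 4 * (w * p) := by linarith
  calc N ^ 3 = N * N * N := by ring
    _ ≤ (4 * (N / 2)) * (4 * (w * p)) * N := by gcongr
    _ = 16 * (N / 2 * w) * (p * N) := by ring
    _ ≤ 16 * W * (3 * W) := by gcongr
    _ ≤ 144 * W ^ 2 := by nlinarith [sq_nonneg W]

theorem card_pow_three_le_queries {V : Type*} [Fintype V] [DecidableEq V] {H : SimpleGraph V}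
    (hH : H ≠ ⊥) {A : QueryAlgorithm (EdgeVar V)} (hA : A.Computes (subgraphIsoFn H)) :
    Fintype.card V ^ 3 ≤ 9216 * (2 * (1296 * A.queries ^ 2)) ^ 2 := by
  have : Nonempty V := by
    by_contra hV
    rw [not_nonempty_iff] at hV
    exact hH (Subsingleton.elim _ _)
  rcases exists_large_indep (card_adj_pairs_le hA)
    (fun G hG => exists_free_card_nonadj_pairs_le hA hG) with h | ⟨S, hS, hc⟩
  · exact h.trans (Nat.mul_le_mul_right _ (by norm_num))
  · exact card_pow_three_le_of_indep hH hA hS hc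

theorem corollary3 :
    ∃ c : ℝ, 0 < c ∧ ∀ (n : ℕ) (H : SimpleGraph (Fin n)), H ≠ ⊥ →
      ENNReal.ofReal (c * (n : ℝ) ^ (3 / 4 : ℝ)) ≤
        ((quantumQueryComplexity (subgraphIsoFn H) : ℕ∞) : ℝ≥0∞) := by
  -- The constant fits because 9216 · 2592² = 248832² ≤ 250000² = 500⁴.
  refine ⟨1 / 500, by norm_num, fun n H hH => ?_⟩
  set r : ℝ := 1 / 500 * (n : ℝ) ^ (3 / 4 : ℝ) with hr
  have hle : ((⌈r⌉₊ : ℕ) : ℕ∞) ≤ quantumQueryComplexity (subgraphIsoFn H) := by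
    refine le_iInf₂ fun A hA => ?_
    rw [Nat.cast_le, Nat.ceil_le]
    have h1 := card_pow_three_le_queries hH hA
    rw [Fintype.card_fin] at h1
    have h2 : (n : ℝ) ^ 3 ≤ (500 * A.queries : ℝ) ^ 4 := by
      have h3 : n ^ 3 ≤ (500 * A.queries) ^ 4 := by
        refine h1.trans ?_
        nlinarith [Nat.zero_le (A.queries ^ 4)]
      exact_mod_cast h3
    have h3 : (n : ℝ) ^ (3 / 4 : ℝ) ≤ 500 * A.queries := by
      have h4 : ((n : ℝ) ^ (3 / 4 : ℝ)) ^ 4 = (n : ℝ) ^ 3 := by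
        rw [← Real.rpow_natCast, ← Real.rpow_mul (Nat.cast_nonneg n), ← Real.rpow_natCast]
        norm_num
      rw [← h4] at h2
      exact le_of_pow_le_pow_left₀ (by norm_num) (by positivity) h2
    rw [hr]
    linarith
  have hle' : (((⌈r⌉₊ : ℕ) : ℕ∞) : ℝ≥0∞) ≤
      ((quantumQueryComplexity (subgraphIsoFn H) : ℕ∞) : ℝ≥0∞) := by
    exact_mod_cast hle
  refine le_trans ?_ hle'
  refine ENNReal.ofReal_le_of_le_toReal ?_
  simpa using Nat.le_ceil r
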